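/- A cograph is a finite simple graph with no induced path on four vertices. For integers $2\le s\le t$, an $(s,t)$-extremal cograph is a cograph that does not contain $K_{s,t}$ as a (not necessarily induced) subgraph and that has the maximum number of edges among all such cographs with the same number of vertices; for $n$ vertices this maximum is denoted by $\mathrm{ex}(n,\{K_{s,t},P_4\text{-ind}\})$. For a subgraph $H$ of a graph $G$ and an integer $k\ge 0$, the graph obtained by pumping $H$ in $G$ $k$ times consists of $G-V(H)$ and $k+1$ disjoint, pairwise non-adjacent copies of $H$, where each copy of a vertex $v$ of $H$ is joined to all neighbours of $v$ in $V(G)\setminus V(H)$. **Theorem 1 (Pumping Theorem).** Let $2\le s\le t$ be integers. There exist integers $N\ge 0$ and $R\ge 1$, cographs $G_0,\dots,G_{R-1}$ with at most $N$ vertices each, connected induced $(t-1)$-regular subgraphs $H_j\subseteq G_j$ such that all vertices of $H_j$ have the same neighbourhood in $V(G_j)\setminus V(H_j)$ and this neighbourhood has exactly $s-1$ vertices ($0\le j<R$), and real constants $a_0,\dots,a_{R-1}<0$, such that: 1. for every sufficiently large $n$, some graph obtained by pumping $H_{n\bmod R}$ in $G_{n\bmod R}$ is an $(s,t)$-extremal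 cograph on $n$ vertices; 2. for every sufficiently large $n$, $$\mathrm{ex}(n,\{K_{s,t},P_4\text{-ind}\})=a_{n\bmod R}+\Bigl(s-1+\frac{t-1}{2}\Bigr)n;$$ 3. there is at least one $q\in\{0,\dots,R-1\}$ such that every $(s,t)$-extremal cograph obtained by pumping $H_q$ in $G_q$ is connected. Moreover, for every integer $n\ge 1$, $$\mathrm{ex}(n,\{K_{s,t},P_4\text{-ind}\})<\Bigl(s-1+\frac{t-1}{2}\Bigr)n.$$ -/

import Mathlib

open Filter

namespace SimpleGraph

/-- A cograph: a graph without an induced path on four vertices. -/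
def IsCograph {V : Type*} (G : SimpleGraph V) : Prop :=
  ¬ (pathGraph 4).IsIndContained G

/-- The induced Turán number `ex(n, {F, H-ind})`: the maximum number of edges in an `n`-vertex graph
that has no subgraph isomorphic to `F` and no induced subgraph isomorphic to `H`. -/
noncomputable def inducedTuranNumber {α β : Type*} (n : ℕ) (F : SimpleGraph α)
    (H : SimpleGraph β) : ℕ :=
  sSup {e : ℕ | ∃ G : SimpleGraph (Fin n),
    F.Free G ∧ ¬ H.IsIndContained G ∧ G.edgeSet.ncard = e}

/-- `G` is an `(s,t)`-extremal cograph: a `K_{s,t}`-free cograph with the maximum number of edges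
among the `K_{s,t}`-free cographs with the same number of vertices. -/
def IsExtremalCograph (s t : ℕ) {V : Type*} [Finite V] (G : SimpleGraph V) : Prop :=
  G.IsCograph ∧ (completeBipartiteGraph (Fin s) (Fin t)).Free G ∧
    ∀ G' : SimpleGraph V, G'.IsCograph → (completeBipartiteGraph (Fin s) (Fin t)).Free G' →
      G'.edgeSet.ncard ≤ G.edgeSet.ncard

/-- The vertices of the graph obtained from `G` by pumping the subgraph `H` in it `k` times: the
vertices of `G` outside `H`, and `k + 1` copies of the vertices of `H`. -/
abbrev PumpVertex {V : Type*} {G : SimpleGraph V} (H : G.Subgraph) (k : ℕ) : Type _ :=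
  {v : V // v ∉ H.verts} ⊕ (Fin (k + 1) × {v : V // v ∈ H.verts})

/-- The graph obtained from `G` by pumping the subgraph `H` in it `k` times: there are `k + 1`
pairwise non-adjacent copies of `H`, and every copy of a vertex `v` of `H` is joined to the
neighbours of `v` in `G` outside `H`. -/
def pump {V : Type*} (G : SimpleGraph V) (H : G.Subgraph) (k : ℕ) :
    SimpleGraph (PumpVertex H k) where
  Adj
    | .inl u, .inl v => G.Adj u v
    | .inl u, .inr (_, v) => G.Adj u v
    | .inr (_, u), .inl v => G.Adj u v
    | .inr (i, u), .inr (j, v) => i = j ∧ H.Adj u v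
  symm := ⟨by
    rintro (u | ⟨i, u⟩) (v | ⟨j, v⟩) h
    · exact G.adj_symm h
    · exact G.adj_symm h
    · exact G.adj_symm h
    · exact ⟨h.1.symm, H.adj_symm h.2⟩⟩
  loopless := ⟨by
    rintro (u | ⟨i, u⟩) h
    · exact G.loopless.irrefl _ h
    · exact G.loopless.irrefl _ (H.adj_sub h.2)⟩

/-- `H` is a connected induced `d`-regular subgraph of `G`, and all of its vertices have the same
neighbourhood outside `H`, which consists of `c` vertices. (So `H` is a connected component of
what remains of `G` when these `c` common neighbours are deleted.) -/
structure IsPumpingComponent {V : Type*} [Finite V] {G : SimpleGraph V} (c d : ℕ)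
    (H : G.Subgraph) : Prop where
  induced : H.IsInduced
  connected : H.Connected
  regular : ∀ v ∈ H.verts, (H.neighborSet v).ncard = d
  common : ∃ W : Set V, W.ncard = c ∧ ∀ v ∈ H.verts, G.neighborSet v \ H.verts = W

end SimpleGraph

/-! Measure an order `n` by its deficiency `δ n = (2s + t - 3) n - 2 ex(n)`, twice the gap to the
claimed slope. A cograph on at least two vertices is a disjoint union or a join
(`P4Free.exists_union_or_join`), and induction along this decomposition gives `δ n > 0` for `n ≥ 1`
(`P4Free.adjCount_le`).

Pumping a `(t - 1)`-regular piece with `s - 1` common outer neighbours creates neither an induced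
path on four vertices nor a `K_{s,t}`, and each new vertex raises the doubled edge count by exactly
`2s + t - 3`, so the deficiency is unchanged. Pumping in `K_{s-1+t}` bounds `δ`; conversely, a large
cograph of bounded deficiency contains such a piece on at most `2t` vertices (`exists_isAttached`).
Hence `δ (n + R) ≤ δ n` for large `n`, where `R = (2t)!`, and `δ` is eventually `R`-periodic. One
extremal graph per residue class, taken large enough, then yields extremal graphs of every large
order by pumping.

For connectivity, take a residue minimising the eventual `δ`: a disconnected extremal graph would
split its deficiency into two positive parts, one of them already at least the minimum. -/

namespace SimpleGraph

/-! ### Cograph decomposition and the upper bound on the number of edges. -/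

section Decomposition

open Finset
open scoped Classical

variable {V : Type*}

/-- No four vertices induce a path. -/
def P4Free (G : SimpleGraph V) : Prop :=
  ∀ a b c d, G.Adj a b → G.Adj b c → G.Adj c d → ¬ G.Adj a c → ¬ G.Adj b d → G.Adj a d

theorem isCograph_iff_p4Free {G : SimpleGraph V} : G.IsCograph ↔ G.P4Free := by
  constructor
  · intro h a b c d hab hbc hcd hac hbd
    by_contra had
    have hac' : a ≠ c := by rintro rfl; exact had hcd
    have hbd' : b ≠ d := by rintro rfl; exact had hab
    have had' : a ≠ d := by rintro rfl; exact hac hcd.symm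
    refine h ⟨⟨⟨![a, b, c, d], ?_⟩, ?_⟩⟩
    · intro i j hij
      have := hab.ne; have := hbc.ne; have := hcd.ne
      fin_cases i <;> fin_cases j <;> simp_all
    · intro i j
      change G.Adj (![a, b, c, d] i) (![a, b, c, d] j) ↔ _
      have := hab.symm; have := hbc.symm; have := hcd.symm
      have : ¬ G.Adj c a := fun h' => hac h'.symm
      have : ¬ G.Adj d b := fun h' => hbd h'.symm
      have : ¬ G.Adj d a := fun h' => had h'.symm
      fin_cases i <;> fin_cases j <;> simp [pathGraph_adj, *]
  · rintro h ⟨f⟩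
    have key : ∀ i j, G.Adj (f i) (f j) ↔ (pathGraph 4).Adj i j := fun i j => f.map_rel_iff
    have := h (f 0) (f 1) (f 2) (f 3)
    simp only [key, pathGraph_adj] at this
    revert this
    decide

/-- The path on four vertices is self-complementary: an induced path `a b c d` of the complement is
the induced path `b d a c` of the graph. -/
theorem P4Free.compl {G : SimpleGraph V} (h : G.P4Free) : Gᶜ.P4Free := by
  intro a b c d hab hbc hcd hac hbd
  simp only [compl_adj, not_and, not_not] at *
  have hac' : a = c ∨ G.Adj a c := by tauto
  have hbd' : b = d ∨ G.Adj b d := by tauto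
  refine ⟨?_, fun had => ?_⟩
  · rintro rfl
    rcases hac' with rfl | hac'
    · exact hcd.1 rfl
    · exact hcd.2 hac'.symm
  · rcases hac' with rfl | hac'
    · exact hcd.2 had
    rcases hbd' with rfl | hbd'
    · exact hab.2 had
    exact hab.2 ((h b d a c hbd' had.symm hac' (fun h' => hab.2 h'.symm)
      (fun h' => hcd.2 h'.symm) |> fun h' => (hbc.2 h').elim))

/-- The number of adjacent pairs in `X × Y`. -/
noncomputable def adjCount (G : SimpleGraph V) (X Y : Finset V) : ℤ :=
  ∑ x ∈ X, ∑ y ∈ Y, if G.Adj x y then 1 else 0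

theorem adjCount_comm (G : SimpleGraph V) (X Y : Finset V) :
    G.adjCount X Y = G.adjCount Y X := by
  unfold adjCount
  rw [sum_comm]
  simp only [G.adj_comm]

theorem adjCount_eq_zero {G : SimpleGraph V} {X Y : Finset V}
    (h : ∀ x ∈ X, ∀ y ∈ Y, ¬ G.Adj x y) : G.adjCount X Y = 0 :=
  sum_eq_zero fun x hx => sum_eq_zero fun y hy => if_neg (h x hx y hy)

theorem adjCount_eq_mul {G : SimpleGraph V} {X Y : Finset V}
    (h : ∀ x ∈ X, ∀ y ∈ Y, G.Adj x y) : G.adjCount X Y = #X * #Y := by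
  have : G.adjCount X Y = ∑ x ∈ X, ∑ y ∈ Y, 1 :=
    sum_congr rfl fun x hx => sum_congr rfl fun y hy => if_pos (h x hx y hy)
  rw [this]
  simp

theorem adjCount_self_le (G : SimpleGraph V) (X : Finset V) :
    G.adjCount X X ≤ #X * (#X - 1) := by
  have : ∀ x ∈ X, (∑ y ∈ X, if G.Adj x y then (1 : ℤ) else 0) ≤ #X - 1 := by
    intro x hx
    rw [← sum_erase_add X _ hx, if_neg (G.irrefl), add_zero]
    refine (sum_le_sum (g := fun _ => 1) fun y _ => by split_ifs <;> simp).trans ?_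
    have := card_pos.2 ⟨x, hx⟩
    rw [sum_const, card_erase_of_mem hx, nsmul_eq_mul, mul_one]
    omega
  refine (sum_le_sum this).trans_eq ?_
  rw [sum_const, nsmul_eq_mul]

/-- `U` contains no complete bipartite subgraph with parts of sizes `s` and `t`. -/
def NoBiclique (G : SimpleGraph V) (U : Finset V) (s t : ℕ) : Prop :=
  ∀ S ⊆ U, ∀ T ⊆ U, #S = s → #T = t → ∃ a ∈ S, ∃ b ∈ T, ¬ G.Adj a b

theorem NoBiclique.mono {G : SimpleGraph V} {U U' : Finset V} {s t : ℕ} (h : G.NoBiclique U s t)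
    (hU : U' ⊆ U) : G.NoBiclique U' s t :=
  fun S hS T hT => h S (hS.trans hU) T (hT.trans hU)

theorem NoBiclique.degree_lt {G : SimpleGraph V} {U : Finset V} {t : ℕ} (h : G.NoBiclique U 1 t) {v : V} (hv : v ∈ U) :
    #{u ∈ U | G.Adj v u} < t := by
  by_contra! ht
  obtain ⟨T, hT, hTc⟩ := exists_subset_card_eq ht
  obtain ⟨a, ha, b, hb, hab⟩ := h {v} (by simpa) T (hT.trans (filter_subset _ _)) (by simp) hTc
  rw [mem_singleton] at ha
  subst ha
  exact hab (mem_filter.1 (hT hb)).2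

theorem adjCount_eq_sum_card (G : SimpleGraph V) (X Y : Finset V) :
    G.adjCount X Y = ∑ x ∈ X, (#{y ∈ Y | G.Adj x y} : ℤ) := by
  simp [adjCount]

variable [DecidableEq V]

/-- `U` is the union of two nonempty disjoint parts with no edge between them. -/
def Splits (G : SimpleGraph V) (U : Finset V) : Prop :=
  ∃ X Y : Finset V, X.Nonempty ∧ Y.Nonempty ∧ Disjoint X Y ∧ X ∪ Y = U ∧
    ∀ x ∈ X, ∀ y ∈ Y, ¬ G.Adj x y

/-- If `v` misses a vertex of `X` and sees some `y` in `Y`, its non-neighbours in `X` are cut off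
from everything else: an edge from such an `a` to a neighbour `b` of `v` in `X` would give the
induced path `a b v y`. Otherwise, up to swapping the sides, `v` either misses a whole side or is
joined to all of `U`. -/
theorem P4Free.splits_insert {G : SimpleGraph V} (h : G.P4Free) {U : Finset V} {v : V}
    (hv : v ∉ U) (hU : G.Splits U) : G.Splits (insert v U) ∨ Gᶜ.Splits (insert v U) := by
  have aux : ∀ X Y : Finset V, Disjoint X Y → X ∪ Y = U → (∀ x ∈ X, ∀ y ∈ Y, ¬ G.Adj x y) →
      (∃ x ∈ X, ¬ G.Adj v x) → (∃ y ∈ Y, G.Adj v y) → G.Splits (insert v U) := by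
    rintro X Y hXY rfl hn ⟨x, hx, hvx⟩ ⟨y, hy, hvy⟩
    refine ⟨X.filter (fun z => ¬ G.Adj v z), insert v (Y ∪ X.filter (fun z => G.Adj v z)),
      ⟨x, by simp [hx, hvx]⟩, ⟨v, by simp⟩, ?_, ?_, ?_⟩
    · rw [Finset.disjoint_left] at *
      intro a ha
      simp only [mem_filter, mem_insert, mem_union, not_or, not_and] at *
      refine ⟨?_, hXY ha.1, fun _ => ha.2⟩
      rintro rfl
      exact hv.1 ha.1
    · ext a
      simp only [mem_filter, mem_insert, mem_union]
      tauto
    · intro a ha b hb hab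
      simp only [mem_filter, mem_insert, mem_union] at *
      rcases hb with rfl | hb | hb
      · exact ha.2 hab.symm
      · exact hn a ha.1 b hb hab
      · exact hn a ha.1 y hy
          (h a b v y hab hb.2.symm hvy (fun h' => ha.2 h'.symm) (hn b hb.1 y hy))
  obtain ⟨X, Y, hX, hY, hXY, hXYU, hn⟩ := hU
  by_cases h1 : ∃ x ∈ X, ¬ G.Adj v x
  · by_cases h2 : ∃ y ∈ Y, G.Adj v y
    · exact Or.inl (aux X Y hXY hXYU hn h1 h2)
    · push Not at h2
      refine Or.inl ⟨insert v X, Y, by simp, hY, ?_, by rw [← hXYU, insert_union], ?_⟩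
      · rw [disjoint_insert_left]
        exact ⟨fun hvY => hv (hXYU ▸ mem_union_right _ hvY), hXY⟩
      · intro a ha b hb
        rcases mem_insert.1 ha with rfl | ha
        exacts [h2 b hb, hn a ha b hb]
  · push Not at h1
    obtain ⟨x, hx⟩ := hX
    by_cases h2 : ∃ y ∈ Y, ¬ G.Adj v y
    · exact Or.inl (aux Y X hXY.symm (by rw [union_comm, hXYU])
        (fun a ha b hb h' => hn b hb a ha h'.symm) h2 ⟨x, hx, h1 x hx⟩)
    · push Not at h2
      refine Or.inr ⟨{v}, U, by simp, ⟨x, hXYU ▸ mem_union_left _ hx⟩, by simpa, rfl, ?_⟩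
      intro a ha b hb hab
      rw [mem_singleton] at ha
      subst ha
      rw [← hXYU, mem_union] at hb
      rcases hb with hb | hb
      exacts [hab.2 (h1 b hb), hab.2 (h2 b hb)]

theorem P4Free.splits_or_compl {G : SimpleGraph V} (h : G.P4Free) (U : Finset V) :
    2 ≤ #U → G.Splits U ∨ Gᶜ.Splits U := by
  induction U using Finset.induction_on with
  | empty => simp
  | insert v U hv ih =>
    intro h2
    rw [card_insert_of_notMem hv] at h2
    by_cases hU : #U = 1
    · obtain ⟨u, rfl⟩ := card_eq_one.1 hU
      have huv : Disjoint ({v} : Finset V) {u} := by simpa using hv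
      by_cases hvu : G.Adj v u
      · exact Or.inr ⟨{v}, {u}, by simp, by simp, huv, rfl, by simp [hvu]⟩
      · exact Or.inl ⟨{v}, {u}, by simp, by simp, huv, rfl, by simp [hvu]⟩
    · rcases ih (by omega) with hs | hs
      · exact h.splits_insert hv hs
      · have := h.compl.splits_insert hv hs
        rw [compl_compl] at this
        exact this.symm

/-- A set of at least two vertices of a cograph is either a disjoint union or a join. -/
theorem P4Free.exists_union_or_join {G : SimpleGraph V} (h : G.P4Free) {U : Finset V}
    (hU : 2 ≤ #U) : ∃ X Y : Finset V, X.Nonempty ∧ Y.Nonempty ∧ Disjoint X Y ∧ X ∪ Y = U ∧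
      ((∀ x ∈ X, ∀ y ∈ Y, ¬ G.Adj x y) ∨ ∀ x ∈ X, ∀ y ∈ Y, G.Adj x y) := by
  rcases h.splits_or_compl U hU with ⟨X, Y, hX, hY, hXY, hU, hn⟩ | ⟨X, Y, hX, hY, hXY, hU, hn⟩
  · exact ⟨X, Y, hX, hY, hXY, hU, Or.inl hn⟩
  · refine ⟨X, Y, hX, hY, hXY, hU, Or.inr fun x hx y hy => ?_⟩
    have := hn x hx y hy
    rw [compl_adj, not_and, not_not] at this
    exact this (fun he => Finset.disjoint_left.1 hXY hx (he ▸ hy))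

theorem adjCount_union (G : SimpleGraph V) {X Y : Finset V} (h : Disjoint X Y) :
    G.adjCount (X ∪ Y) (X ∪ Y) = G.adjCount X X + G.adjCount Y Y + 2 * G.adjCount X Y := by
  have : G.adjCount (X ∪ Y) (X ∪ Y) =
      G.adjCount X X + G.adjCount X Y + (G.adjCount Y X + G.adjCount Y Y) := by
    unfold adjCount
    simp only [sum_union h, sum_add_distrib]
  rw [this, G.adjCount_comm Y X]
  ring

section Join

variable {G : SimpleGraph V} {X Y : Finset V} {s t : ℕ}

/-- All of `Y` can be added to the `t`-side of any biclique inside `X`. -/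
theorem NoBiclique.left_of_join (h : G.NoBiclique (X ∪ Y) s t) (hd : Disjoint X Y)
    (hj : ∀ x ∈ X, ∀ y ∈ Y, G.Adj x y) (hY : #Y ≤ t) : G.NoBiclique X s (t - #Y) := by
  intro S hS T hT hSc hTc
  obtain ⟨a, ha, b, hb, hab⟩ := h S (hS.trans subset_union_left) (T ∪ Y)
    (union_subset_union hT subset_rfl) hSc
    (by rw [card_union_of_disjoint (disjoint_of_subset_left hT hd)]; omega)
  rcases mem_union.1 hb with hb | hb
  · exact ⟨a, ha, b, hb, hab⟩
  · exact absurd (hj a (hS ha) b hb) hab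

theorem NoBiclique.card_lt_of_join (h : G.NoBiclique (X ∪ Y) s t)
    (hj : ∀ x ∈ X, ∀ y ∈ Y, G.Adj x y) (hY : t ≤ #Y) : #X < s := by
  by_contra! hX
  obtain ⟨S, hS, hSc⟩ := exists_subset_card_eq hX
  obtain ⟨T, hT, hTc⟩ := exists_subset_card_eq hY
  obtain ⟨a, ha, b, hb, hab⟩ := h S (hS.trans subset_union_left) T (hT.trans subset_union_right)
    hSc hTc
  exact hab (hj a (hS ha) b (hT hb))

/-- All of `X` can be added to the `s`-side of any biclique inside `Y`. -/
theorem NoBiclique.right_of_join (h : G.NoBiclique (X ∪ Y) s t) (hd : Disjoint X Y)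
    (hj : ∀ x ∈ X, ∀ y ∈ Y, G.Adj x y) (hX : #X ≤ s) : G.NoBiclique Y (s - #X) t := by
  intro S hS T hT hSc hTc
  obtain ⟨a, ha, b, hb, hab⟩ := h (S ∪ X)
    (union_subset (hS.trans subset_union_right) subset_union_left) T
    (hT.trans subset_union_right)
    (by rw [card_union_of_disjoint (disjoint_of_subset_left hS hd.symm)]; omega) hTc
  rcases mem_union.1 ha with ha | ha
  · exact ⟨a, ha, b, hb, hab⟩
  · exact absurd (hj a ha b (hT hb)) hab

end Join

/-- A `K_{s,t}`-free cograph on `U` has at most `(s - 1 + (t - 1) / 2) |U|` edges, and fewer if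
`2 ≤ s` and `U` is nonempty. -/
theorem P4Free.adjCount_le {G : SimpleGraph V} (h : G.P4Free) (U : Finset V) (s t : ℕ)
    (hs : 1 ≤ s) (ht : 1 ≤ t) (hU : G.NoBiclique U s t) :
    G.adjCount U U ≤ (2 * s + t - 3) * #U ∧
      (2 ≤ s → U.Nonempty → G.adjCount U U < (2 * s + t - 3) * #U) := by
  induction hn : #U using Nat.strong_induction_on generalizing U s t with
  | _ n ih =>
  rcases lt_or_ge (#U) 2 with hlt | hge
  · have h1 := G.adjCount_self_le U
    rw [hn] at h1 hlt
    have h2 : (n : ℤ) * (n - 1) ≤ 0 := by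
      interval_cases n <;> simp
    refine ⟨?_, fun hs2 hne => ?_⟩
    · refine (h1.trans h2).trans (mul_nonneg ?_ ?_) <;> omega
    · have := card_pos.2 hne
      refine (h1.trans h2).trans_lt (mul_pos ?_ ?_) <;> omega
  -- Here `Y` excludes `K_{s-|X|,t}`. The slope lost on `Y` is repaid exactly by the `2|X||Y|` cross
  -- pairs, while `X`, with fewer than `s` vertices, stays strictly below its share.
  have large : ∀ X Y : Finset V, X.Nonempty → Y.Nonempty → Disjoint X Y → X ∪ Y = U →
      (∀ x ∈ X, ∀ y ∈ Y, G.Adj x y) → t ≤ #Y → G.adjCount U U < (2 * s + t - 3) * n := by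
    rintro X Y hX hY hd rfl hj htY
    have hXs := hU.card_lt_of_join hj htY
    rw [card_union_of_disjoint hd] at hn
    have hXp := card_pos.2 hX
    have ihY := (ih (#Y) (by omega) Y (s - #X) t (by omega) ht
      (hU.right_of_join hd hj hXs.le) rfl).1
    rw [G.adjCount_union hd, adjCount_eq_mul hj, ← hn]
    have hXX := G.adjCount_self_le X
    push_cast [hXs.le] at ihY ⊢
    have : (#X : ℤ) * (#X - 1) < #X * (2 * s + t - 3) :=
      mul_lt_mul_of_pos_left (by omega) (by omega)
    linarith
  obtain ⟨X, Y, hX, hY, hd, rfl, hn' | hj⟩ := h.exists_union_or_join hge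
  · rw [card_union_of_disjoint hd] at hn
    have hXp := card_pos.2 hX
    have hYp := card_pos.2 hY
    obtain ⟨h1, h1'⟩ := ih (#X) (by omega) X s t hs ht (hU.mono subset_union_left) rfl
    obtain ⟨h2, -⟩ := ih (#Y) (by omega) Y s t hs ht (hU.mono subset_union_right) rfl
    rw [G.adjCount_union hd, adjCount_eq_zero hn', ← hn]
    push_cast
    refine ⟨by linarith, fun hs2 _ => ?_⟩
    have := h1' hs2 hX
    linarith
  · rcases le_or_gt t (#Y) with htY | htY
    · have := large X Y hX hY hd rfl hj htY
      exact ⟨this.le, fun _ _ => this⟩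
    rcases le_or_gt t (#X) with htX | htX
    · have := large Y X hY hX hd.symm (union_comm _ _) (fun y hy x hx => (hj x hx y hy).symm) htX
      exact ⟨this.le, fun _ _ => this⟩
    rw [card_union_of_disjoint hd] at hn
    have hXp := card_pos.2 hX
    have hYp := card_pos.2 hY
    -- With both sides smaller than `t`, each side lowers the other's `t` by its own size; the two
    -- losses `|X||Y|` cancel the cross term exactly.
    obtain ⟨h1, h1'⟩ := ih (#X) (by omega) X s (t - #Y) hs (by omega)
      (hU.left_of_join hd hj htY.le) rfl
    obtain ⟨h2, -⟩ := ih (#Y) (by omega) Y s (t - #X) hs (by omega)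
      ((union_comm X Y ▸ hU).left_of_join hd.symm (fun y hy x hx => (hj x hx y hy).symm)
        htX.le) rfl
    rw [G.adjCount_union hd, adjCount_eq_mul hj, ← hn]
    push_cast [htY.le, htX.le] at h1 h1' h2 ⊢
    refine ⟨by linarith, fun hs2 _ => ?_⟩
    have := h1' hs2 hX
    linarith

end Decomposition
-- Finding a small regular piece in a cograph of bounded deficiency.
section Attached

open Finset
open scoped Classical

variable {V : Type*} [DecidableEq V] {G : SimpleGraph V} {U X Y W C : Finset V} {d : ℕ}

/-- `C` is a connected `d`-regular part of `U`, and all of its vertices have the neighbourhood `W`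
in `U` outside `C`. -/
structure IsAttached (G : SimpleGraph V) (U W C : Finset V) (d : ℕ) : Prop where
  subset : C ⊆ U
  connected : (G.induce (C : Set V)).Connected
  regular : ∀ v ∈ C, #{u ∈ C | G.Adj v u} = d
  common : ∀ v ∈ C, {u ∈ U \ C | G.Adj v u} = W

theorem IsAttached.union (h : G.IsAttached X W C d)
    (hn : ∀ x ∈ X, ∀ y ∈ Y, ¬ G.Adj x y) : G.IsAttached (X ∪ Y) W C d where
  subset := h.subset.trans subset_union_left
  connected := h.connected
  regular := h.regular
  common v hv := by
    rw [← h.common v hv]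
    ext u
    have := hn v (h.subset hv) u
    simp only [mem_filter, Finset.mem_sdiff, mem_union]
    tauto

theorem IsAttached.join (h : G.IsAttached Y W C d) (hd : Disjoint X Y)
    (hj : ∀ x ∈ X, ∀ y ∈ Y, G.Adj x y) : G.IsAttached (X ∪ Y) (X ∪ W) C d where
  subset := h.subset.trans subset_union_right
  connected := h.connected
  regular := h.regular
  common v hv := by
    rw [← h.common v hv]
    ext u
    have h1 : u ∈ X → G.Adj v u := fun hu => (hj u hu v (h.subset hv)).symm
    have h2 : u ∈ X → u ∉ C := fun hu hC => Finset.disjoint_left.1 hd hu (h.subset hC)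
    simp only [mem_filter, Finset.mem_sdiff, mem_union]
    tauto

theorem IsAttached.subset_neighbors (h : G.IsAttached U W C d) : W ⊆ U := by
  obtain ⟨v, hv⟩ := h.connected.nonempty
  rw [← h.common v hv]
  exact (filter_subset _ _).trans sdiff_subset

theorem connected_induce_union_of_join (hX : X.Nonempty) (hY : Y.Nonempty)
    (hj : ∀ x ∈ X, ∀ y ∈ Y, G.Adj x y) : (G.induce ((X ∪ Y : Finset V) : Set V)).Connected := by
  obtain ⟨x₀, hx₀⟩ := hX
  obtain ⟨y₀, hy₀⟩ := hY
  have hx₀' : x₀ ∈ ((X ∪ Y : Finset V) : Set V) := by simp [hx₀]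
  have hy₀' : y₀ ∈ ((X ∪ Y : Finset V) : Set V) := by simp [hy₀]
  have h0 : (G.induce ((X ∪ Y : Finset V) : Set V)).Adj ⟨y₀, hy₀'⟩ ⟨x₀, hx₀'⟩ :=
    (hj x₀ hx₀ y₀ hy₀).symm
  refine connected_iff_exists_forall_reachable _ |>.2 ⟨⟨x₀, hx₀'⟩, ?_⟩
  rintro ⟨z, hz⟩
  rcases mem_union.1 (mem_coe.1 hz) with hzX | hzY
  · have h1 : (G.induce ((X ∪ Y : Finset V) : Set V)).Adj ⟨z, hz⟩ ⟨y₀, hy₀'⟩ := hj z hzX y₀ hy₀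
    exact (h1.reachable.trans h0.reachable).symm
  · have h1 : (G.induce ((X ∪ Y : Finset V) : Set V)).Adj ⟨x₀, hx₀'⟩ ⟨z, hz⟩ := hj x₀ hx₀ z hzY
    exact h1.reachable

/-- A nonempty `(t - 1)`-regular cograph has a connected component with at most `2 * t` vertices. -/
theorem P4Free.exists_isAttached_of_regular (h : G.P4Free) (U : Finset V) {t : ℕ} (ht : 1 ≤ t)
    (hU : G.NoBiclique U 1 t) (hne : U.Nonempty) (hreg : ∀ v ∈ U, #{u ∈ U | G.Adj v u} = t - 1) :
    ∃ C, G.IsAttached U ∅ C (t - 1) ∧ #C ≤ 2 * t := by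
  induction hn : #U using Nat.strong_induction_on generalizing U with
  | _ n ih =>
  have whole : (G.induce (U : Set V)).Connected → #U ≤ 2 * t →
      ∃ C, G.IsAttached U ∅ C (t - 1) ∧ #C ≤ 2 * t := fun hc hle =>
    ⟨U, ⟨subset_rfl, hc, hreg, fun v _ => by simp⟩, hle⟩
  rcases lt_or_ge (#U) 2 with hlt | hge
  · have hpos := card_pos.2 hne
    obtain ⟨v, rfl⟩ := card_eq_one.1 (by omega : #U = 1)
    refine whole ?_ (by simp; omega)
    rw [coe_singleton]
    exact ⟨fun a b => by rw [Subsingleton.elim a b]⟩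
  obtain ⟨X, Y, hX, hY, hd, rfl, hn' | hj⟩ := h.exists_union_or_join hge
  · rw [card_union_of_disjoint hd] at hn
    have hYp := card_pos.2 hY
    obtain ⟨C, hC, hCt⟩ := ih (#X) (by omega) X (hU.mono subset_union_left) hX (fun v hv => by
      rw [← hreg v (mem_union_left _ hv), filter_union,
        filter_false_of_mem (s := Y) (hn' v hv), union_empty]) rfl
    exact ⟨C, hC.union hn', hCt⟩
  · refine whole (connected_induce_union_of_join hX hY hj) ?_
    -- A side with `t` vertices would leave a vertex of the other side with degree at least `t`.
    have h1 : #Y < t := by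
      by_contra! hc
      have := hU.card_lt_of_join hj hc
      have := card_pos.2 hX
      omega
    have h2 : #X < t := by
      by_contra! hc
      have := (union_comm X Y ▸ hU).card_lt_of_join (fun y hy x hx => (hj x hx y hy).symm) hc
      have := card_pos.2 hY
      omega
    rw [card_union_of_disjoint hd]
    omega

/-- Excluding `K_{1,t}` caps every degree at `t - 1`, so attaining the bound forces regularity. -/
theorem P4Free.exists_isAttached_of_adjCount_eq (h : G.P4Free) {t : ℕ} (ht : 1 ≤ t)
    (hU : G.NoBiclique U 1 t) (hne : U.Nonempty) (hc : (t - 1) * #U ≤ G.adjCount U U) :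
    ∃ C, G.IsAttached U ∅ C (t - 1) ∧ #C ≤ 2 * t := by
  refine h.exists_isAttached_of_regular U ht hU hne ?_
  by_contra! hcon
  obtain ⟨v, hv, hvt⟩ := hcon
  rw [adjCount_eq_sum_card] at hc
  have : ∑ x ∈ U, (#{y ∈ U | G.Adj x y} : ℤ) < ∑ x ∈ U, ((t : ℤ) - 1) := by
    refine sum_lt_sum (fun x hx => ?_) ⟨v, hv, ?_⟩
    · have := hU.degree_lt hx
      omega
    · have := hU.degree_lt hv
      omega
  rw [sum_const, nsmul_eq_mul, mul_comm] at this
  exact absurd hc (not_le.2 this)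

/-- A large `K_{s,t}`-free cograph whose number of edges is within a constant of
`(s - 1 + (t - 1) / 2) n` has a small connected `(t - 1)`-regular part with `s - 1` common
neighbours outside. -/
theorem exists_isAttached (s t : ℕ) (hs : 1 ≤ s) (ht : 1 ≤ t) (D : ℕ) :
    ∃ N : ℕ, ∀ (n : ℕ) (G : SimpleGraph (Fin n)) (U : Finset (Fin n)), G.P4Free →
      G.NoBiclique U s t → N ≤ #U → (2 * s + t - 3) * #U - D ≤ G.adjCount U U →
      ∃ W C, G.IsAttached U W C (t - 1) ∧ #W = s - 1 ∧ #C ≤ 2 * t := by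
  induction s using Nat.strong_induction_on generalizing D with
  | _ s ihs =>
  induction D with
  | zero =>
    refine ⟨1, fun n G U hG hU hN hD => ?_⟩
    have hne : U.Nonempty := card_pos.1 hN
    rcases hs.eq_or_lt with rfl | hs2
    · obtain ⟨C, hC, hCt⟩ := hG.exists_isAttached_of_adjCount_eq ht hU hne
        (by push_cast at hD; linarith)
      exact ⟨∅, C, hC, by simp, hCt⟩
    · have := (hG.adjCount_le U s t hs ht hU).2 hs2 hne
      push_cast at hD
      omega
  | succ D ihD =>
    -- Unions will lower the deficiency at the same `s`; joins will lower `s` at the same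
    -- deficiency, hence the two nested inductions.
    obtain ⟨N₁, hN₁⟩ := ihD
    choose N₂ hN₂ using fun s' : {s' : ℕ // s' < s ∧ 1 ≤ s'} =>
      ihs s'.1 s'.2.1 s'.2.2 (D + 1)
    obtain ⟨M, hM⟩ : ∃ M, ∀ s' : {s' : ℕ // s' < s ∧ 1 ≤ s'}, N₂ s' ≤ M := by
      have : Finite {s' : ℕ // s' < s ∧ 1 ≤ s'} :=
        ((Set.finite_lt_nat s).subset fun _ hx => hx.1).to_subtype
      obtain ⟨M, hM⟩ := (Set.finite_range N₂).bddAbove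
      exact ⟨M, fun s' => hM ⟨s', rfl⟩⟩
    -- The factor 2 makes the larger of the two parts exceed every threshold needed.
    refine ⟨2 * (s + t + M + N₁ + 1), fun n G U hG hU hN hD => ?_⟩
    have union_case : ∀ X Y : Finset (Fin n), X.Nonempty → Y.Nonempty → Disjoint X Y →
        X ∪ Y = U → (∀ x ∈ X, ∀ y ∈ Y, ¬ G.Adj x y) → #Y ≤ #X →
        ∃ W C, G.IsAttached U W C (t - 1) ∧ #W = s - 1 ∧ #C ≤ 2 * t := by
      rintro X Y hX hY hd rfl hn hYX
      rw [card_union_of_disjoint hd] at hN hD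
      rw [G.adjCount_union hd, adjCount_eq_zero hn] at hD
      have bY := hG.adjCount_le Y s t hs ht (hU.mono subset_union_right)
      push_cast at hD
      -- If `Y` is strictly below its bound it uses at least one unit of deficiency, leaving at most
      -- `D` for `X`. Otherwise `s = 1` and `Y` itself is regular.
      by_cases hYD : G.adjCount Y Y < (2 * s + t - 3) * #Y
      · obtain ⟨W, C, hC, hW, hCt⟩ := hN₁ n G X hG (hU.mono subset_union_left) (by omega)
          (by linarith)
        exact ⟨W, C, hC.union hn, hW, hCt⟩
      · rcases hs.eq_or_lt with rfl | hs2
        · obtain ⟨C, hC, hCt⟩ := hG.exists_isAttached_of_adjCount_eq ht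
            (hU.mono subset_union_right) hY (by push_cast at hYD; linarith)
          refine ⟨∅, C, ?_, by simp, hCt⟩
          rw [union_comm]
          exact hC.union fun y hy x hx hxy => hn x hx y hy hxy.symm
        · exact absurd (bY.2 hs2 hY) hYD
    have join_case : ∀ X Y : Finset (Fin n), X.Nonempty → Y.Nonempty → Disjoint X Y →
        X ∪ Y = U → (∀ x ∈ X, ∀ y ∈ Y, G.Adj x y) → #X ≤ #Y →
        ∃ W C, G.IsAttached U W C (t - 1) ∧ #W = s - 1 ∧ #C ≤ 2 * t := by
      rintro X Y hX hY hd rfl hj hXY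
      rw [card_union_of_disjoint hd] at hN hD
      rw [G.adjCount_union hd, adjCount_eq_mul hj] at hD
      -- The small side joins the common neighbourhood: the `s - |X| - 1` neighbours found in `Y`
      -- become `s - 1`.
      have hXs := hU.card_lt_of_join hj (by omega)
      have hXp := card_pos.2 hX
      have hXX := G.adjCount_self_le X
      have hs' : s - #X < s ∧ 1 ≤ s - #X := by omega
      have : (#X : ℤ) * (#X - 1) ≤ #X * (2 * s + t - 3) :=
        mul_le_mul_of_nonneg_left (by omega) (by omega)
      have hNY := hM ⟨_, hs'⟩
      obtain ⟨W, C, hC, hW, hCt⟩ := hN₂ ⟨_, hs'⟩ n G Y hG (hU.right_of_join hd hj hXs.le)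
        (by omega) (by push_cast [hXs.le] at hD ⊢; linarith)
      refine ⟨X ∪ W, C, hC.join hd hj, ?_, hCt⟩
      rw [card_union_of_disjoint (disjoint_of_subset_right hC.subset_neighbors hd), hW]
      dsimp only
      omega
    obtain ⟨X, Y, hX, hY, hd, hXY, hn | hj⟩ := hG.exists_union_or_join (U := U) (by omega)
    · rcases le_total (#Y) (#X) with hle | hle
      · exact union_case X Y hX hY hd hXY hn hle
      · exact union_case Y X hY hX hd.symm (by rw [union_comm, hXY])
          (fun y hy x hx hxy => hn x hx y hy hxy.symm) hle
    · rcases le_total (#X) (#Y) with hle | hle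
      · exact join_case X Y hX hY hd hXY hj hle
      · exact join_case Y X hY hX hd.symm (by rw [union_comm, hXY])
          (fun y hy x hx => (hj x hx y hy).symm) hle

end Attached
-- Pumping preserves the two exclusions and the deficiency.
section Pump

open Finset
open scoped Classical

variable {V : Type*} {G : SimpleGraph V}

theorem free_completeBipartiteGraph_iff {s t : ℕ} :
    (completeBipartiteGraph (Fin s) (Fin t)).Free G ↔
      ∀ S T : Finset V, #S = s → #T = t → ∃ a ∈ S, ∃ b ∈ T, ¬ G.Adj a b := by
  unfold Free
  rw [completeBipartiteGraph_isContained_iff]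
  simp only [Fintype.card_fin, IsCompleteBetween, not_exists, not_and, not_forall, mem_coe,
    exists_prop]

theorem noBiclique_of_free {s t : ℕ} (h : (completeBipartiteGraph (Fin s) (Fin t)).Free G)
    (U : Finset V) : G.NoBiclique U s t :=
  fun S _ T _ => free_completeBipartiteGraph_iff.1 h S T

theorem two_mul_ncard_edgeSet [Fintype V] (G : SimpleGraph V) :
    2 * (G.edgeSet.ncard : ℤ) = G.adjCount univ univ := by
  rw [adjCount_eq_sum_card, ← coe_edgeFinset, Set.ncard_coe_finset]
  have := G.sum_degrees_eq_twice_card_edges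
  rw [← Nat.cast_two, ← Nat.cast_mul, ← this, Nat.cast_sum]
  refine sum_congr rfl fun v _ => ?_
  rw [← card_neighborFinset_eq_degree, neighborFinset_eq_filter]

namespace PumpVertex

variable {H : G.Subgraph} {k : ℕ}

/-- The vertex of `G` of which a vertex of the pumped graph is a copy. -/
def base : PumpVertex H k → V
  | .inl u => u
  | .inr (_, u) => u

/-- Two vertices that do not lie in different copies of `H`. -/
def Compatible : PumpVertex H k → PumpVertex H k → Prop
  | .inr (i, _), .inr (j, _) => i = j
  | _, _ => True

theorem Compatible.eq {x y : PumpVertex H k} (h : Compatible x y) (hxy : base x = base y) :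
    x = y := by
  rcases x with ⟨x, hx⟩ | ⟨i, x, hx⟩ <;> rcases y with ⟨y, hy⟩ | ⟨j, y, hy⟩ <;>
    simp only [base, Compatible] at hxy h <;> subst hxy
  · rfl
  · exact absurd hy hx
  · exact absurd hx hy
  · subst h; rfl

end PumpVertex

open PumpVertex

section

variable {H : G.Subgraph} {k : ℕ}

@[simp] theorem pump_adj_inl_inl {u v : {v : V // v ∉ H.verts}} :
    (G.pump H k).Adj (.inl u) (.inl v) ↔ G.Adj u v := Iff.rfl

@[simp] theorem pump_adj_inl_inr {u : {v : V // v ∉ H.verts}} {i : Fin (k + 1)}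
    {v : {v : V // v ∈ H.verts}} : (G.pump H k).Adj (.inl u) (.inr (i, v)) ↔ G.Adj u v := Iff.rfl

@[simp] theorem pump_adj_inr_inl {u : {v : V // v ∉ H.verts}} {i : Fin (k + 1)}
    {v : {v : V // v ∈ H.verts}} : (G.pump H k).Adj (.inr (i, v)) (.inl u) ↔ G.Adj v u := Iff.rfl

@[simp] theorem pump_adj_inr_inr {i j : Fin (k + 1)} {u v : {v : V // v ∈ H.verts}} :
    (G.pump H k).Adj (.inr (i, u)) (.inr (j, v)) ↔ i = j ∧ H.Adj u v := Iff.rfl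

theorem pump_adj_base {x y : PumpVertex H k} (h : (G.pump H k).Adj x y) :
    G.Adj (base x) (base y) := by
  rcases x with x | ⟨i, x⟩ <;> rcases y with y | ⟨j, y⟩
  exacts [h, h, h, H.adj_sub h.2]

end

namespace IsPumpingComponent

variable [Finite V] {H : G.Subgraph} {c d : ℕ}

/-- The union of the copies is a module of the pumped graph. An induced path on four vertices is
prime and connected, so it meets this module in at most one vertex or lies in a single copy; either
way it projects to an induced path of `G`. The proof checks the cases directly. -/
theorem p4Free_pump (h : IsPumpingComponent c d H) (hG : G.P4Free) (k : ℕ) :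
    (G.pump H k).P4Free := by
  obtain ⟨W, -, hW⟩ := h.common
  have hind : ∀ u v : {v : V // v ∈ H.verts}, H.Adj u v ↔ G.Adj u v := fun u v =>
    ⟨fun h' => H.adj_sub h', fun h' => h.induced u.2 v.2 h'⟩
  have hW1 : ∀ (u : {v : V // v ∈ H.verts}) (w : {v : V // v ∉ H.verts}),
      G.Adj u w ↔ (w : V) ∈ W := fun u w => by
    rw [← hW u u.2]
    exact ⟨fun h' => ⟨h', w.2⟩, fun h' => h'.1⟩
  have hW2 : ∀ (u : {v : V // v ∈ H.verts}) (w : {v : V // v ∉ H.verts}),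
      G.Adj w u ↔ (w : V) ∈ W := fun u w => by rw [G.adj_comm, hW1]
  intro x y z w
  have := hG (base x) (base y) (base z) (base w)
  rcases x with x | ⟨i, x⟩ <;> rcases y with y | ⟨j, y⟩ <;> rcases z with z | ⟨l, z⟩ <;>
    rcases w with w | ⟨m, w⟩ <;>
    simp only [base, pump_adj_inl_inl, pump_adj_inl_inr, pump_adj_inr_inl, pump_adj_inr_inr, hW1,
      hW2, hind] at this ⊢ <;> grind

/-- Vertices in different copies have all their common neighbours in `W`. -/
theorem card_le_of_not_compatible (h : IsPumpingComponent c d H) {k : ℕ} {x y : PumpVertex H k}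
    (hxy : ¬ Compatible x y) (T : Finset (PumpVertex H k))
    (hT : ∀ z ∈ T, (G.pump H k).Adj x z ∧ (G.pump H k).Adj y z) : #T ≤ c := by
  obtain ⟨W, hWc, hW⟩ := h.common
  rcases x with x | ⟨i, x⟩ <;> rcases y with y | ⟨j, y⟩ <;> simp only [Compatible, not_true] at hxy
  have key : ∀ z ∈ T, ∃ w : {v : V // v ∉ H.verts}, z = .inl w ∧ (w : V) ∈ W := by
    intro z hz
    obtain ⟨h1, h2⟩ := hT z hz
    rcases z with w | ⟨l, z⟩
    · refine ⟨w, rfl, ?_⟩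
      rw [← hW x x.2]
      exact ⟨h1, w.2⟩
    · exact absurd (h1.1.trans h2.1.symm) hxy
  rw [← hWc, ← Set.ncard_coe_finset]
  refine Set.ncard_le_ncard_of_injOn base ?_ ?_ (Set.toFinite _)
  · intro z hz
    obtain ⟨w, rfl, hw⟩ := key z hz
    exact hw
  · intro z hz z' hz' hzz
    obtain ⟨w, rfl, hw⟩ := key z hz
    obtain ⟨w', rfl, hw'⟩ := key z' hz'
    exact Compatible.eq trivial hzz

/-- A side of a biclique meeting two copies would leave at most `c` vertices for the other side. So
`base` is injective on each side, and the biclique projects to one in `G`. -/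
theorem free_pump (h : IsPumpingComponent c d H) {s t : ℕ} (hs : c < s) (ht : c < t)
    (hG : (completeBipartiteGraph (Fin s) (Fin t)).Free G) (k : ℕ) :
    (completeBipartiteGraph (Fin s) (Fin t)).Free (G.pump H k) := by
  rw [free_completeBipartiteGraph_iff] at hG ⊢
  intro S T hS hT
  by_contra! hcon
  have inj : ∀ A : Finset (PumpVertex H k), (∀ x ∈ A, ∀ y ∈ A, Compatible x y) →
      #(A.image base) = #A := fun A hA =>
    card_image_of_injOn fun x hx y hy hxy => (hA x hx y hy).eq hxy
  have hSc : ∀ x ∈ S, ∀ y ∈ S, Compatible x y := by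
    by_contra! hc
    obtain ⟨x, hx, y, hy, hxy⟩ := hc
    have := h.card_le_of_not_compatible hxy T fun z hz => ⟨hcon x hx z hz, hcon y hy z hz⟩
    omega
  have hTc : ∀ x ∈ T, ∀ y ∈ T, Compatible x y := by
    by_contra! hc
    obtain ⟨x, hx, y, hy, hxy⟩ := hc
    have := h.card_le_of_not_compatible hxy S
      fun z hz => ⟨(hcon z hz x hx).symm, (hcon z hz y hy).symm⟩
    omega
  obtain ⟨a, ha, b, hb, hab⟩ := hG (S.image base) (T.image base) (by rw [inj S hSc, hS])
    (by rw [inj T hTc, hT])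
  obtain ⟨x, hx, rfl⟩ := mem_image.1 ha
  obtain ⟨y, hy, rfl⟩ := mem_image.1 hb
  exact hab (pump_adj_base (hcon x hx y hy))

/-- Each copy of `H` together with the rest is a homomorphic image of `G`, and all these images
share a vertex `w` of `W`, which exists because `1 ≤ c`. -/
theorem connected_pump (h : IsPumpingComponent c d H) (hc : 1 ≤ c) (hG : G.Connected) (k : ℕ) :
    (G.pump H k).Connected := by
  obtain ⟨W, hWc, hW⟩ := h.common
  obtain ⟨v, hv⟩ := h.connected.nonempty
  have hne : W.Nonempty := by
    rw [← Set.ncard_pos, hWc]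
    exact hc
  obtain ⟨w, hw⟩ := hne
  have hwH : w ∉ H.verts := by
    rw [← hW v hv] at hw
    exact hw.2
  let σ (i : Fin (k + 1)) (u : V) : PumpVertex H k :=
    if hu : u ∈ H.verts then .inr (i, ⟨u, hu⟩) else .inl ⟨u, hu⟩
  have hσ : ∀ (i : Fin (k + 1)) {u u' : V}, G.Adj u u' → (G.pump H k).Adj (σ i u) (σ i u') := by
    intro i u u' huu
    by_cases hu : u ∈ H.verts <;> by_cases hu' : u' ∈ H.verts <;> simp [σ, hu, hu', huu]
    exact h.induced hu hu' huu
  have hr : ∀ i u, (G.pump H k).Reachable (.inl ⟨w, hwH⟩) (σ i u) := by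
    intro i u
    have := (hG.preconnected w u).map (⟨σ i, hσ i⟩ : G →g G.pump H k)
    simpa [σ, hwH] using this
  refine connected_iff_exists_forall_reachable _ |>.2 ⟨.inl ⟨w, hwH⟩, ?_⟩
  rintro (⟨u, hu⟩ | ⟨i, u, hu⟩)
  · simpa [σ, hu] using hr 0 u
  · simpa [σ, hu] using hr i u

theorem card_pumpVertex (H : G.Subgraph) (k : ℕ) :
    Nat.card (PumpVertex H k) = Nat.card V + k * H.verts.ncard := by
  have h1 := Nat.card_congr (Equiv.sumCompl (fun v => v ∈ H.verts))
  rw [Nat.card_sum] at h1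
  rw [PumpVertex, Nat.card_sum, Nat.card_prod, Nat.card_fin, ← h1, ← Nat.card_coe_set_eq]
  change _ = Nat.card {v // v ∈ H.verts} + _ + k * Nat.card {v // v ∈ H.verts}
  ring

/-- Each added vertex has `d` neighbours in its copy, where edges are shared by two new vertices,
and `c` outside. With `c = s - 1` and `d = t - 1` the factor is `2s + t - 3`. -/
theorem ncard_edgeSet_pump (h : IsPumpingComponent c d H) (k : ℕ) :
    2 * ((G.pump H k).edgeSet.ncard : ℤ) =
      2 * G.edgeSet.ncard + k * H.verts.ncard * (2 * c + d) := by
  have := Fintype.ofFinite V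
  obtain ⟨W, hWc, hW⟩ := h.common
  set P : Finset V := {v | v ∈ H.verts} with hP
  set Q : Finset V := {v | v ∉ H.verts} with hQ
  have hout : ∀ v ∈ H.verts, (∑ u ∈ Q, if G.Adj v u then (1 : ℤ) else 0) = c := by
    intro v hv
    rw [sum_boole, ← hWc, ← hW v hv, ← Set.ncard_coe_finset]
    congr 2
    ext u
    simp [hQ, and_comm]
  have hin : ∀ v ∈ H.verts, (∑ u ∈ P, if H.Adj v u then (1 : ℤ) else 0) = d := by
    intro v hv
    rw [sum_boole, ← h.regular v hv, ← Set.ncard_coe_finset]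
    congr 2
    ext u
    simp only [hP, coe_filter, mem_filter, mem_univ, true_and, Set.mem_ofPred_eq,
      Subgraph.mem_neighborSet]
    exact ⟨fun h' => h'.2, fun h' => ⟨H.edge_vert h'.symm, h'⟩⟩
  have hPc : (#P : ℤ) = H.verts.ncard := by
    rw [← Set.ncard_coe_finset]
    congr 2
    ext; simp [hP]
  have sP : ∀ f : V → ℤ, ∑ u : {v // v ∈ H.verts}, f u = ∑ u ∈ P, f u := fun f =>
    (sum_subtype P (by simp [hP]) f).symm
  have sQ : ∀ f : V → ℤ, ∑ u : {v // v ∉ H.verts}, f u = ∑ u ∈ Q, f u := fun f =>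
    (sum_subtype Q (by simp [hQ]) f).symm
  have hPQ : G.adjCount P Q = #P * c := by
    rw [adjCount, sum_congr rfl fun v hv => hout v (by simpa [hP] using hv)]
    simp
  have hPP : G.adjCount P P = #P * d := by
    rw [adjCount, sum_congr rfl fun v hv => ?_]
    rotate_left
    · exact fun _ => d
    · rw [← hin v (by simpa [hP] using hv)]
      refine sum_congr rfl fun u hu => ?_
      have : G.Adj v u ↔ H.Adj v u :=
        ⟨fun h' => h.induced (by simpa [hP] using hv) (by simpa [hP] using hu) h',
          fun h' => H.adj_sub h'⟩
      simp only [this]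
    simp
  have hG : G.adjCount univ univ = #P * d + G.adjCount Q Q + 2 * (#P * c) := by
    have hd : Disjoint P Q := disjoint_filter_filter_not _ _ _
    have hu : (univ : Finset V) = P ∪ Q := (filter_union_filter_not_eq _ _).symm
    rw [hu, adjCount_union G hd, hPP, hPQ]
  have hpump : (G.pump H k).adjCount univ univ =
      G.adjCount Q Q + 2 * ((k + 1) * (#P * c)) + (k + 1) * (#P * d) := by
    have e1 : ∀ u : {v // v ∉ H.verts}, ∀ v : {v // v ∈ H.verts}, G.Adj u v ↔ G.Adj v u :=
      fun u v => G.adj_comm _ _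
    have c1 : ∑ u : {v // v ∉ H.verts}, ∑ v : {v // v ∈ H.verts},
        (if G.Adj u v then (1 : ℤ) else 0) = #P * c := by
      rw [sum_comm, ← hPQ, adjCount, ← sP]
      refine sum_congr rfl fun u _ => ?_
      rw [← sQ]
      simp only [e1]
    have c2 : ∑ u : {v // v ∈ H.verts}, ∑ v : {v // v ∉ H.verts},
        (if G.Adj u v then (1 : ℤ) else 0) = #P * c := by
      rw [← hPQ, adjCount, ← sP]
      exact sum_congr rfl fun u _ => by rw [← sQ]
    have c3 : ∑ u : {v // v ∈ H.verts}, ∑ v : {v // v ∈ H.verts},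
        (if H.Adj u v then (1 : ℤ) else 0) = #P * d := by
      rw [sum_congr rfl fun (u : {v // v ∈ H.verts}) _ => (sP (fun v => if H.Adj u v then (1 : ℤ) else 0)).trans
        (hin u u.2)]
      simp [hP, Fintype.card_subtype]
    have c4 : ∑ u : {v // v ∉ H.verts}, ∑ v : {v // v ∉ H.verts},
        (if G.Adj u v then (1 : ℤ) else 0) = G.adjCount Q Q := by
      rw [adjCount, ← sQ]
      exact sum_congr rfl fun u _ => by rw [← sQ]
    unfold adjCount
    simp only [Fintype.sum_sum_type, Fintype.sum_prod_type, pump_adj_inl_inl, pump_adj_inl_inr,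
      pump_adj_inr_inl, pump_adj_inr_inr, ite_and, sum_add_distrib, sum_const, card_univ,
      Fintype.card_fin, nsmul_eq_mul]
    have c5 : ∀ (i : Fin (k + 1)) (u : {v // v ∈ H.verts}), (∑ j : Fin (k + 1),
        ∑ v : {v // v ∈ H.verts}, if i = j then (if H.Adj u v then (1 : ℤ) else 0) else 0) =
        ∑ v : {v // v ∈ H.verts}, if H.Adj u v then (1 : ℤ) else 0 := by
      intro i u
      rw [sum_comm]
      simp
    simp only [c5, c2, c3, c4, ← mul_sum, c1, sum_const, card_univ, Fintype.card_fin,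
      nsmul_eq_mul]
    unfold adjCount
    push_cast
    ring
  rw [two_mul_ncard_edgeSet G, hG, ← hPc]
  have := two_mul_ncard_edgeSet (G.pump H k)
  rw [this]
  refine Eq.trans ?_ (hpump.trans (by ring))
  congr!

end IsPumpingComponent

end Pump
-- The Turán number and extremal cographs with a pumping piece.
section Turan

open Finset
open scoped Classical

variable {V : Type*} {G : SimpleGraph V} {s t : ℕ}

/-- The maximum number of edges of a `K_{s,t}`-free cograph on `n` vertices. -/
noncomputable abbrev cographTuran (s t n : ℕ) : ℕ :=
  inducedTuranNumber n (completeBipartiteGraph (Fin s) (Fin t)) (pathGraph 4)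

theorem bddAbove_edge_counts (s t n : ℕ) : BddAbove {e : ℕ | ∃ G : SimpleGraph (Fin n),
    (completeBipartiteGraph (Fin s) (Fin t)).Free G ∧ ¬ (pathGraph 4).IsIndContained G ∧
      G.edgeSet.ncard = e} :=
  ((Set.finite_range fun G : SimpleGraph (Fin n) => G.edgeSet.ncard).subset (by
    rintro e ⟨G, -, -, rfl⟩
    exact ⟨G, rfl⟩)).bddAbove

theorem ncard_edgeSet_le_cographTuran [Finite V] {n : ℕ} (hn : Nat.card V = n)
    (hG : G.IsCograph) (hf : (completeBipartiteGraph (Fin s) (Fin t)).Free G) :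
    G.edgeSet.ncard ≤ cographTuran s t n := by
  obtain ⟨e⟩ : Nonempty (Fin n ≃ V) := ⟨(Finite.equivFinOfCardEq hn).symm⟩
  let φ := Iso.comap e G
  refine le_csSup (bddAbove_edge_counts s t n) ⟨G.comap e, ?_, ?_, ?_⟩
  · exact fun h => hf (h.trans ⟨φ.toCopy⟩)
  · exact fun h => hG (h.trans ⟨φ.toEmbedding⟩)
  · rw [← Nat.card_coe_set_eq, ← Nat.card_coe_set_eq]
    exact Nat.card_congr φ.mapEdgeSet

theorem p4Free_bot : (⊥ : SimpleGraph V).P4Free := fun _ _ _ _ h => h.elim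

theorem exists_ncard_eq_cographTuran (hs : 1 ≤ s) (ht : 1 ≤ t) (n : ℕ) :
    ∃ G : SimpleGraph (Fin n), G.IsCograph ∧
      (completeBipartiteGraph (Fin s) (Fin t)).Free G ∧ G.edgeSet.ncard = cographTuran s t n := by
  obtain ⟨G, h1, h2, h3⟩ := Nat.sSup_mem (s := {e : ℕ | ∃ G : SimpleGraph (Fin n),
      (completeBipartiteGraph (Fin s) (Fin t)).Free G ∧ ¬ (pathGraph 4).IsIndContained G ∧
      G.edgeSet.ncard = e}) ⟨_, ⊥, by
        rw [free_completeBipartiteGraph_iff]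
        intro S T hS hT
        obtain ⟨a, ha⟩ := card_pos.1 (hS ▸ hs)
        obtain ⟨b, hb⟩ := card_pos.1 (hT ▸ ht)
        exact ⟨a, ha, b, hb, id⟩, isCograph_iff_p4Free.2 p4Free_bot, rfl⟩
    (bddAbove_edge_counts s t n)
  exact ⟨G, h2, h1, h3⟩

theorem isExtremalCograph_of_ncard_ge [Finite V] (hG : G.IsCograph)
    (hf : (completeBipartiteGraph (Fin s) (Fin t)).Free G)
    (h : cographTuran s t (Nat.card V) ≤ G.edgeSet.ncard) : G.IsExtremalCograph s t :=
  ⟨hG, hf, fun _ hG' hf' => (ncard_edgeSet_le_cographTuran rfl hG' hf').trans h⟩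

theorem cographTuran_lt (hs : 2 ≤ s) (ht : 1 ≤ t) {n : ℕ} (hn : 1 ≤ n) :
    2 * (cographTuran s t n : ℤ) < (2 * s + t - 3) * n := by
  obtain ⟨G, hG, hf, he⟩ := exists_ncard_eq_cographTuran (s := s) (t := t) (by omega) ht n
  have : Nonempty (Fin n) := ⟨⟨0, hn⟩⟩
  have h := ((isCograph_iff_p4Free.1 hG).adjCount_le univ s t (by omega) ht
    (noBiclique_of_free hf _)).2 hs univ_nonempty
  rwa [← two_mul_ncard_edgeSet, he, card_univ, Fintype.card_fin] at h

theorem adjCount_le_cographTuran (hG : G.IsCograph)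
    (hf : (completeBipartiteGraph (Fin s) (Fin t)).Free G) (U : Finset V) :
    G.adjCount U U ≤ 2 * cographTuran s t #U := by
  have h1 : (G.induce (U : Set V)).IsCograph := fun h => hG (h.trans ⟨Embedding.induce _⟩)
  have h2 : (completeBipartiteGraph (Fin s) (Fin t)).Free (G.induce (U : Set V)) :=
    fun h => hf (h.trans ⟨(Embedding.induce _).toCopy⟩)
  have h3 := ncard_edgeSet_le_cographTuran (n := #U) (by simp) h1 h2
  have h4 : G.adjCount U U = (G.induce (U : Set V)).adjCount univ univ := by
    have e : ∀ f : V → ℤ, ∑ x : (U : Set V), f x = ∑ x ∈ U, f x := fun f =>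
      (sum_subtype U (fun _ => Iff.rfl) f).symm
    unfold adjCount
    rw [← e]
    refine sum_congr rfl fun x _ => ?_
    rw [← e]
    rfl
  rw [h4, ← two_mul_ncard_edgeSet]
  exact_mod_cast Nat.mul_le_mul_left 2 h3

/-- Add an isolated vertex: it lies on no induced path on four vertices and in no biclique with
nonempty sides. -/
theorem cographTuran_mono (hs : 1 ≤ s) (ht : 1 ≤ t) : Monotone (cographTuran s t) := by
  refine monotone_nat_of_le_succ fun n => ?_
  obtain ⟨G, hG, hf, he⟩ := exists_ncard_eq_cographTuran hs ht n
  rw [isCograph_iff_p4Free] at hG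
  rw [free_completeBipartiteGraph_iff] at hf
  let e : Fin n ↪ Fin (n + 1) := Fin.castSuccEmb
  have hadj : ∀ {a b}, (G.map e).Adj a b → ∃ a' b', G.Adj a' b' ∧ e a' = a ∧ e b' = b :=
    fun {a b} h => (map_adj e G a b).1 h
  have hadj' : ∀ {a b}, (G.map e).Adj (e a) (e b) ↔ G.Adj a b := map_adj_apply
  have h1 : (G.map e).IsCograph := by
    rw [isCograph_iff_p4Free]
    intro a b c d hab hbc hcd
    obtain ⟨a, b, -, rfl, rfl⟩ := hadj hab
    obtain ⟨c, d, -, rfl, rfl⟩ := hadj hcd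
    simp only [hadj'] at *
    exact hG a b c d hab hbc hcd
  have h2 : (completeBipartiteGraph (Fin s) (Fin t)).Free (G.map e) := by
    rw [free_completeBipartiteGraph_iff]
    intro S T hS hT
    by_contra! hcon
    obtain ⟨a₀, ha₀⟩ := card_pos.1 (hS ▸ hs)
    obtain ⟨b₀, hb₀⟩ := card_pos.1 (hT ▸ ht)
    have hS' : ∃ S' : Finset (Fin n), S'.map e = S := by
      refine ⟨S.preimage e e.injective.injOn, ?_⟩
      rw [map_eq_image, image_preimage, filter_true_of_mem]
      intro a ha
      obtain ⟨a', -, -, h, -⟩ := hadj (hcon a ha b₀ hb₀)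
      exact ⟨a', h⟩
    have hT' : ∃ T' : Finset (Fin n), T'.map e = T := by
      refine ⟨T.preimage e e.injective.injOn, ?_⟩
      rw [map_eq_image, image_preimage, filter_true_of_mem]
      intro b hb
      obtain ⟨-, b', -, -, h⟩ := hadj (hcon a₀ ha₀ b hb)
      exact ⟨b', h⟩
    obtain ⟨S, rfl⟩ := hS'
    obtain ⟨T, rfl⟩ := hT'
    rw [card_map] at hS hT
    obtain ⟨a, ha, b, hb, hab⟩ := hf S T hS hT
    exact hab (hadj'.1 (hcon _ (mem_map_of_mem e ha) _ (mem_map_of_mem e hb)))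
  have h3 := ncard_edgeSet_le_cographTuran (n := n + 1) (by simp) h1 h2
  rw [edgeSet_map, Set.ncard_image_of_injective _ e.sym2Map.injective, he] at h3
  exact h3

/-- Pumping in any `K_{s,t}`-free cograph gives a lower bound on the Turán number. -/
theorem IsPumpingComponent.le_cographTuran [Finite V] (hs : 1 ≤ s) (hst : s ≤ t) {H : G.Subgraph}
    (h : IsPumpingComponent (s - 1) (t - 1) H) (hG : G.IsCograph)
    (hf : (completeBipartiteGraph (Fin s) (Fin t)).Free G) (k : ℕ) :
    2 * (G.edgeSet.ncard : ℤ) + (2 * s + t - 3) * (k * H.verts.ncard) ≤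
      2 * cographTuran s t (Nat.card V + k * H.verts.ncard) := by
  have h1 := ncard_edgeSet_le_cographTuran (IsPumpingComponent.card_pumpVertex H k)
    (isCograph_iff_p4Free.2 (h.p4Free_pump (isCograph_iff_p4Free.1 hG) k))
    (h.free_pump (by omega) (by omega) hf k)
  have h2 := h.ncard_edgeSet_pump k
  push_cast [hs, hs.trans hst] at h2
  linarith

/-- Pump a `K_t` inside `K_{s-1+t}`, which has too few vertices for `K_{s,t}`; monotonicity fills
the gaps of length below `t` between the orders reached. -/
theorem exists_le_cographTuran (hs : 2 ≤ s) (hst : s ≤ t) :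
    ∃ D : ℕ, ∀ n : ℕ, (2 * s + t - 3) * (n : ℤ) - D ≤ 2 * cographTuran s t n := by
  let A : Set (Fin (s - 1 + t)) := {v | s - 1 ≤ (v : ℕ)}
  have hA' : Aᶜ.ncard = s - 1 := by
    have : Aᶜ = Set.range (Fin.castAdd t : Fin (s - 1) → _) := by
      ext v
      simp only [A, Set.mem_compl_iff, Set.mem_ofPred_eq, not_le, Set.mem_range]
      exact ⟨fun h => ⟨⟨v, h⟩, rfl⟩, by rintro ⟨w, rfl⟩; exact w.2⟩
    rw [this, ← Set.image_univ, Set.ncard_image_of_injective _ (Fin.castAdd_injective _ _),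
      Set.ncard_univ, Nat.card_fin]
  have hA : A.ncard = t := by
    have := Set.ncard_add_ncard_compl A
    rw [hA', Nat.card_fin] at this
    omega
  let H : (⊤ : SimpleGraph (Fin (s - 1 + t))).Subgraph := (⊤ : Subgraph _).induce A
  have hne : A.Nonempty := by
    rw [← Set.ncard_pos, hA]
    omega
  have hH : IsPumpingComponent (s - 1) (t - 1) H := by
    refine ⟨fun u hu v hv h => ⟨hu, hv, h⟩, ⟨?_⟩, fun v hv => ?_, Aᶜ, hA', fun v hv => ?_⟩
    · have : Nonempty H.verts := hne.to_subtype
      have hr : (⊤ : SimpleGraph A) ≤ H.coe := by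
        intro u v huv
        exact ⟨u.2, v.2, fun h => huv (Subtype.ext h)⟩
      exact Connected.mono hr connected_top
    · have : H.neighborSet v = A \ {v} := by
        ext u
        change (v ∈ A ∧ u ∈ A ∧ v ≠ u) ↔ _
        have : v ∈ A := hv
        simp [this, eq_comm]
      rw [this, Set.ncard_sdiff_singleton_of_mem (show v ∈ A from hv), hA]
    · ext u
      change (v ≠ u ∧ u ∉ A) ↔ u ∉ A
      have : v ∈ A := hv
      exact ⟨fun h => h.2, fun h => ⟨fun h' => h (h' ▸ this), h⟩⟩
  have hcog : (⊤ : SimpleGraph (Fin (s - 1 + t))).IsCograph := by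
    rw [isCograph_iff_p4Free]
    intro a b c d _ _ hcd hac _
    have : a = c := by simpa using hac
    exact this ▸ hcd
  have hfree : (completeBipartiteGraph (Fin s) (Fin t)).Free
      (⊤ : SimpleGraph (Fin (s - 1 + t))) := by
    rw [free_completeBipartiteGraph_iff]
    intro S T hS hT
    by_contra! hcon
    have hd : Disjoint S T := by
      rw [Finset.disjoint_left]
      intro a ha hb
      exact (hcon a ha a hb) rfl
    have := card_le_univ (S ∪ T)
    rw [card_union_of_disjoint hd, Fintype.card_fin] at this
    omega
  -- Fewer than `s + 2t` vertices remain uncounted: the initial clique has `s - 1 + t` and the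
  -- remainder modulo `t` is below `t`.
  refine ⟨(2 * s + t) * (s + 2 * t), fun n => ?_⟩
  rcases lt_or_ge n (s + 2 * t) with hn | hn
  · have h1 : (2 * s + t - 3) * (n : ℤ) ≤ (2 * s + t) * (s + 2 * t) :=
      mul_le_mul (by omega) (by omega) (by omega) (by omega)
    push_cast
    linarith [Int.natCast_nonneg (cographTuran s t n)]
  · have h1 := hH.le_cographTuran (by omega) hst hcog hfree ((n - (s - 1 + t)) / t)
    have hv : H.verts.ncard = t := hA
    have hmod := Nat.div_add_mod (n - (s - 1 + t)) t
    have hlt := Nat.mod_lt (n - (s - 1 + t)) (by omega : t > 0)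
    rw [mul_comm] at hmod
    rw [hv, Nat.card_fin] at h1
    set m := (n - (s - 1 + t)) / t * t with hm
    have hmn : s - 1 + t + m ≤ n := by omega
    have h2 : (cographTuran s t (s - 1 + t + m) : ℤ) ≤ cographTuran s t n := by
      exact_mod_cast cographTuran_mono (by omega) (by omega) hmn
    have h3 : (2 * s + t - 3) * ((n : ℤ) - m) ≤ (2 * s + t) * (s + 2 * t) :=
      mul_le_mul (by omega) (by omega) (by omega) (by omega)
    have h4 : (((n - (s - 1 + t)) / t : ℕ) : ℤ) * t = m := by rw [hm]; push_cast; rfl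
    rw [h4] at h1
    push_cast
    have h5 := Int.natCast_nonneg (⊤ : SimpleGraph (Fin (s - 1 + t))).edgeSet.ncard
    linarith

theorem IsAttached.isPumpingComponent [Fintype V] [DecidableEq V] {W C : Finset V} {d : ℕ}
    (h : G.IsAttached univ W C d) :
    IsPumpingComponent #W d ((⊤ : G.Subgraph).induce (C : Set V)) where
  induced := fun _ hu _ hv h' => ⟨hu, hv, h'⟩
  connected := (connected_induce_iff).1 h.connected
  regular v hv := by
    rw [← h.regular v hv, ← Set.ncard_coe_finset]
    congr 1
    ext u
    have hv' : v ∈ C := hv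
    simp [hv']
  common := by
    refine ⟨W, Set.ncard_coe_finset _, fun v hv => ?_⟩
    rw [← h.common v hv]
    ext u
    simp [and_comm]

/-- Every large order admits an extremal cograph with a small pumping component. -/
theorem exists_extremal_isPumpingComponent (hs : 2 ≤ s) (hst : s ≤ t) :
    ∃ N : ℕ, ∀ n ≥ N, ∃ (G : SimpleGraph (Fin n)) (H : G.Subgraph), G.IsCograph ∧
      (completeBipartiteGraph (Fin s) (Fin t)).Free G ∧ G.edgeSet.ncard = cographTuran s t n ∧
      IsPumpingComponent (s - 1) (t - 1) H ∧ 1 ≤ H.verts.ncard ∧ H.verts.ncard ≤ 2 * t := by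
  obtain ⟨D, hD⟩ := exists_le_cographTuran hs hst
  obtain ⟨N, hN⟩ := exists_isAttached s t (by omega) (by omega) D
  refine ⟨N, fun n hn => ?_⟩
  obtain ⟨G, hG, hf, he⟩ :=
    exists_ncard_eq_cographTuran (s := s) (t := t) (by omega) (by omega) n
  obtain ⟨W, C, hC, hW, hCt⟩ := hN n G univ (isCograph_iff_p4Free.1 hG)
    (noBiclique_of_free hf _) (by simpa) (by
      rw [← two_mul_ncard_edgeSet, he, card_univ, Fintype.card_fin]
      exact hD n)
  refine ⟨G, _, hG, hf, he, hW ▸ hC.isPumpingComponent, ?_, ?_⟩ <;>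
    simp only [Subgraph.induce_verts, Set.ncard_coe_finset]
  · exact card_pos.2 (by
      obtain ⟨v, hv⟩ := hC.connected.nonempty
      exact ⟨v, hv⟩)
  · exact hCt

theorem splits_univ_of_not_connected [Fintype V] [DecidableEq V] [Nonempty V] (h : ¬ G.Connected) :
    G.Splits univ := by
  rw [connected_iff_exists_forall_reachable] at h
  push Not at h
  obtain ⟨v⟩ := ‹Nonempty V›
  obtain ⟨w, hw⟩ := h v
  refine ⟨univ.filter fun u => G.Reachable v u, univ.filter fun u => ¬ G.Reachable v u,
    ⟨v, by simp⟩, ⟨w, by simpa⟩,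
    disjoint_filter_filter_not _ _ _, filter_union_filter_not_eq _ _, fun x hx y hy hxy => ?_⟩
  simp only [mem_filter, mem_univ, true_and] at hx hy
  exact hy (hx.trans hxy.reachable)

end Turan

end SimpleGraph

/-! ### Eventual periodicity and the Pumping Theorem. -/

/-- A sequence of natural numbers that is eventually nonincreasing along steps of length `R` is
eventually `R`-periodic. -/
theorem Nat.exists_eventually_periodic {δ : ℕ → ℕ} {R N : ℕ} (hR : 0 < R)
    (h : ∀ n ≥ N, δ (n + R) ≤ δ n) :
    ∃ M ≥ N, ∀ m ≥ M, ∀ n ≥ M, m % R = n % R → δ m = δ n := by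
  have anti : ∀ j, Antitone fun i => δ (N + j + R * i) := fun j =>
    antitone_nat_of_succ_le fun i => by
      have := h (N + j + R * i) (by rw [add_assoc]; exact Nat.le_add_right _ _)
      rwa [add_assoc, ← Nat.mul_succ] at this
  have stab : ∀ j, ∃ i₀, ∀ i ≥ i₀, δ (N + j + R * i) = δ (N + j + R * i₀) := fun j => by
    obtain ⟨i₀, hi₀⟩ := WellFoundedLT.antitone_chain_condition (anti j)
    exact ⟨i₀, fun i hi => (hi₀ i hi).symm⟩
  choose i₀ hi₀ using stab
  -- There are finitely many residue classes, so the largest stabilisation index serves all of them.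
  have red : ∀ n ≥ N + R * (Finset.range R).sup i₀,
      δ n = δ (N + (n - N) % R + R * i₀ ((n - N) % R)) := by
    intro n hn
    rw [← hi₀ ((n - N) % R) ((n - N) / R), add_assoc, Nat.mod_add_div,
      Nat.add_sub_cancel' ((Nat.le_add_right _ _).trans hn)]
    rw [ge_iff_le, Nat.le_div_iff_mul_le hR, mul_comm]
    refine (Nat.mul_le_mul_left R (Finset.le_sup (Finset.mem_range.2 (Nat.mod_lt _ hR)))).trans ?_
    omega
  refine ⟨N + R * (Finset.range R).sup i₀, Nat.le_add_right _ _, fun m hm n hn hmn => ?_⟩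
  have hmod : (m - N) % R = (n - N) % R := by
    refine Nat.ModEq.add_left_cancel' N ?_
    rw [Nat.add_sub_cancel' ((Nat.le_add_right _ _).trans hm),
      Nat.add_sub_cancel' ((Nat.le_add_right _ _).trans hn)]
    exact hmn
  rw [red m hm, red n hn, hmod]

theorem theorem1 (s t : ℕ) (hs : 2 ≤ s) (hst : s ≤ t) :
    (∃ (N R : ℕ) (hR : 0 < R) (m : Fin R → ℕ) (G : (j : Fin R) → SimpleGraph (Fin (m j)))
      (H : (j : Fin R) → (G j).Subgraph) (a : Fin R → ℝ),
      (∀ j, m j ≤ N ∧ (G j).IsCograph ∧ SimpleGraph.IsPumpingComponent (s - 1) (t - 1) (H j)) ∧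
      (∀ᶠ n : ℕ in atTop, ∃ k : ℕ,
        Nat.card (SimpleGraph.PumpVertex (H ⟨n % R, Nat.mod_lt n hR⟩) k) = n ∧
        SimpleGraph.IsExtremalCograph s t
          ((G ⟨n % R, Nat.mod_lt n hR⟩).pump (H ⟨n % R, Nat.mod_lt n hR⟩) k)) ∧
      (∀ j, a j < 0) ∧
      (∀ᶠ n : ℕ in atTop,
        (SimpleGraph.inducedTuranNumber n (completeBipartiteGraph (Fin s) (Fin t))
          (SimpleGraph.pathGraph 4) : ℝ) =
            a ⟨n % R, Nat.mod_lt n hR⟩ + ((s : ℝ) - 1 + ((t : ℝ) - 1) / 2) * (n : ℝ)) ∧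
      (∃ q : Fin R, ∀ k : ℕ,
        SimpleGraph.IsExtremalCograph s t ((G q).pump (H q) k) →
          ((G q).pump (H q) k).Connected)) ∧
    (∀ n : ℕ, 1 ≤ n →
      (SimpleGraph.inducedTuranNumber n (completeBipartiteGraph (Fin s) (Fin t))
        (SimpleGraph.pathGraph 4) : ℝ) < ((s : ℝ) - 1 + ((t : ℝ) - 1) / 2) * (n : ℝ)) := by
  obtain ⟨N, hN⟩ := SimpleGraph.exists_extremal_isPumpingComponent hs hst
  let f := SimpleGraph.cographTuran s t
  have hlt : ∀ n : ℕ, 1 ≤ n → 2 * (f n : ℤ) < (2 * s + t - 3) * n := fun n hn =>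
    SimpleGraph.cographTuran_lt hs (by omega) hn
  -- Truncation by `toNat` is harmless for `n ≥ 1`, where the integer is positive.
  let δ : ℕ → ℕ := fun n => ((2 * s + t - 3) * (n : ℤ) - 2 * f n).toNat
  have hδ : ∀ n : ℕ, 1 ≤ n → (δ n : ℤ) = (2 * s + t - 3) * n - 2 * f n := fun n hn =>
    Int.toNat_of_nonneg (by linarith [hlt n hn])
  have hδpos : ∀ n : ℕ, 1 ≤ n → 0 < (δ n : ℤ) := fun n hn => by
    rw [hδ n hn]
    linarith [hlt n hn]
  have toReal : ∀ n : ℕ, 1 ≤ n → (δ n : ℝ) = (2 * s + t - 3) * n - 2 * f n := fun n hn => by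
    exact_mod_cast hδ n hn
  refine ⟨?_, fun n hn => ?_⟩
  swap
  · have h1 : (0 : ℝ) < δ n := by exact_mod_cast hδpos n hn
    rw [toReal n hn] at h1
    change (f n : ℝ) < _
    linarith
  have hR := Nat.factorial_pos (2 * t)
  -- Every possible piece has between 1 and `2t` vertices, so its order divides `R`.
  set R := (2 * t).factorial
  have hstep : ∀ n ≥ N + 1, δ (n + R) ≤ δ n := by
    intro n hn
    obtain ⟨G, H, hG, hf, he, hH, h1, h2⟩ := hN n (by omega)
    have h3 := hH.le_cographTuran (by omega) hst hG hf (R / H.verts.ncard)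
    rw [he, ← Nat.cast_mul, Nat.div_mul_cancel (Nat.dvd_factorial h1 h2), Nat.card_fin] at h3
    have h4 := hδ n (by omega)
    have h5 := hδ (n + R) (by omega)
    push_cast at h5
    zify
    change 2 * (f n : ℤ) + _ ≤ 2 * f (n + R) at h3
    linarith
  obtain ⟨M, hMN, hM⟩ := Nat.exists_eventually_periodic hR hstep
  -- The order is at least `2M`, not just `M`, so that one side of any bipartition of the vertices
  -- has at least `M` of them.
  let ord : Fin R → ℕ := fun j => j + R * (2 * M)
  have hord_mod : ∀ j, ord j % R = j := fun j => by
    simp only [ord, Nat.add_mul_mod_self_left, Nat.mod_eq_of_lt j.2]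
  have hord_ge : ∀ j, 2 * M ≤ ord j := fun j =>
    (Nat.le_mul_of_pos_left _ hR).trans (Nat.le_add_left _ _)
  have hord_le : ∀ j, ord j ≤ R + R * (2 * M) := fun j => Nat.add_le_add_right j.2.le _
  choose G H hG hf he hH h1 h2 using fun j => hN (ord j) (by have := hord_ge j; omega)
  have hδord : ∀ n (hn : M ≤ n), δ n = δ (ord ⟨n % R, Nat.mod_lt n hR⟩) := fun n hn =>
    hM n hn _ (by have := hord_ge ⟨n % R, Nat.mod_lt n hR⟩; omega)
      (hord_mod ⟨n % R, Nat.mod_lt n hR⟩).symm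
  -- The constant is minus half the eventual deficiency of the class.
  refine ⟨R + R * (2 * M), R, hR, ord, G, H, fun j => -(δ (ord j) : ℝ) / 2,
    fun j => ⟨hord_le j, hG j, hH j⟩, ?_, fun j => ?_, ?_, ?_⟩
  · filter_upwards [eventually_ge_atTop (R + R * (2 * M)), eventually_ge_atTop M] with n hn hnM
    set j : Fin R := ⟨n % R, Nat.mod_lt n hR⟩ with hj
    have hle := (hord_le j).trans hn
    have hdvd : (H j).verts.ncard ∣ n - ord j :=
      (Nat.dvd_factorial (h1 j) (h2 j)).trans
        ((Nat.modEq_iff_dvd' hle).1 ((hord_mod j).trans rfl))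
    obtain ⟨k, hk⟩ := hdvd
    have hcard : Nat.card (SimpleGraph.PumpVertex (H j) k) = n := by
      rw [SimpleGraph.IsPumpingComponent.card_pumpVertex, Nat.card_fin, mul_comm, ← hk]
      omega
    refine ⟨k, hcard, SimpleGraph.isExtremalCograph_of_ncard_ge ?_ ?_ ?_⟩
    · exact SimpleGraph.isCograph_iff_p4Free.2
        ((hH j).p4Free_pump (SimpleGraph.isCograph_iff_p4Free.1 (hG j)) k)
    · exact (hH j).free_pump (by omega) (by omega) (hf j) k
    · rw [hcard]
      have e1 := (hH j).ncard_edgeSet_pump k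
      have e2 := hδ n (by omega)
      have e3 := hδ (ord j) (by have := hord_ge j; omega)
      rw [hδord n hnM, e3] at e2
      rw [he j] at e1
      have e4 : (k : ℤ) * (H j).verts.ncard = n - ord j := by
        rw [mul_comm, ← Nat.cast_mul, ← hk, Nat.cast_sub hle]
      rw [e4] at e1
      push_cast [(by omega : 1 ≤ s), (by omega : 1 ≤ t)] at e1
      change f n ≤ _
      change _ = 2 * (f (ord j) : ℤ) + _ at e1
      zify
      linarith
  · have := hδpos (ord j) (by have := hord_ge j; omega)
    have : (0 : ℝ) < δ (ord j) := by exact_mod_cast this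
    linarith
  · filter_upwards [eventually_ge_atTop M] with n hn
    have e := toReal n (by omega)
    rw [hδord n hn] at e
    change (f n : ℝ) = _
    linarith
  · have : Nonempty (Fin R) := ⟨⟨0, hR⟩⟩
    -- It suffices that `G q` itself be connected, since pumping with `s - 1 ≥ 1` common neighbours
    -- keeps connectivity.
    obtain ⟨q, hq⟩ := Finite.exists_min fun j => δ (ord j)
    refine ⟨q, fun k _ => (hH q).connected_pump (by omega) ?_ k⟩
    by_contra hcon
    have hge := hord_ge q
    have : Nonempty (Fin (ord q)) := ⟨⟨0, by omega⟩⟩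
    obtain ⟨X, Y, hX, hY, hd, hXY, hn⟩ := SimpleGraph.splits_univ_of_not_connected hcon
    have hXp := Finset.card_pos.2 hX
    have hYp := Finset.card_pos.2 hY
    have hc : X.card + Y.card = ord q := by
      rw [← Finset.card_union_of_disjoint hd, hXY, Finset.card_univ, Fintype.card_fin]
    have e1 := SimpleGraph.two_mul_ncard_edgeSet (G q)
    rw [he q, ← hXY, SimpleGraph.adjCount_union _ hd, SimpleGraph.adjCount_eq_zero hn] at e1
    have e2 := SimpleGraph.adjCount_le_cographTuran (hG q) (hf q) X
    have e3 := SimpleGraph.adjCount_le_cographTuran (hG q) (hf q) Y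
    have d1 := hδ X.card hXp
    have d2 := hδ Y.card hYp
    have d3 := hδ (ord q) (by omega)
    have p1 := hδpos X.card hXp
    have p2 := hδpos Y.card hYp
    have hcZ : (X.card : ℤ) + Y.card = ord q := by exact_mod_cast hc
    -- Both sides induce admissible graphs and no edge crosses, so deficiencies add up to at most
    -- that of `G q`.
    have hsum : (δ X.card : ℤ) + δ Y.card ≤ δ (ord q) := by
      rw [d1, d2, d3, ← hcZ]
      simp only [f]
      linarith
    rcases le_or_gt M X.card with hXM | hXM
    · have := hq ⟨X.card % R, Nat.mod_lt _ hR⟩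
      rw [← hδord _ hXM] at this
      omega
    · have := hq ⟨Y.card % R, Nat.mod_lt _ hR⟩
      rw [← hδord Y.card (by omega)] at this
      omega
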